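/- Let $\mathbb{K}=\mathbb{C}$ or $\mathbb{K}=\mathbb{R}$, and let $X=\ell_p(\mathbb{Z})$ with $1\le p<\infty$ or $X=c_0(\mathbb{Z})$, over $\mathbb{K}$ with the usual norm. Let $w=(w_n)_{n\in\mathbb{Z}}$ be a bounded sequence in $\mathbb{K}$ and let $$B_w:(x_n)_{n\in\mathbb{Z}}\in X\mapsto (w_{n+1}x_{n+1})_{n\in\mathbb{Z}}\in X$$ be the bilateral weighted backward shift on $X$; assume that $B_w$ is invertible. Suppose that - $B_w$ is expansive: there is $e>0$ such that for all $x\neq y$ in $X$ there is $n\in\mathbb{Z}$ with $\|B_w^n x-B_w^n y\|\ge e$; and - $B_w$ is strongly structurally stable: for every $\gamma>0$ there is $\varepsilon>0$ such that for every bounded Lipschitz map $\varphi:X\to X$ with $\sup_{x\in X}\|\varphi(x)\|\le\varepsilon$ and Lipschitz constant at most $\varepsilon$ there is a homeomorphism $h:X\to X$ with $h\circ B_w=(B_w+\varphi)\circ h$ and $\sup_{x\in X}\|h(x)-x\|\le\gamma$. Then $B_w$ is hyperbolic: the spectrum of $B_w$ (of the complexification of $B_w$, if $\mathbb{K}=\mathbb{R}$)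 does not intersect the unit circle $\{\lambda\in\mathbb{C}:|\lambda|=1\}$. -/

import Mathlib

open scoped ENNReal NNReal ZeroAtInfty BoundedContinuousFunction

noncomputable section

/-! ### Bilateral weighted backward shifts -/

section Shifts

variable {𝕜 : Type*} [RCLike 𝕜]

theorem memℓp_backwardShift {p : ℝ≥0∞} [hp1 : Fact (1 ≤ p)] {w : ℤ → 𝕜}
    (hw : BddAbove (Set.range fun n => ‖w n‖)) {x : ℤ → 𝕜} (hx : Memℓp x p) :
    Memℓp (fun n => w (n + 1) * x (n + 1)) p := by
  have hC : ∀ n, ‖w n‖ ≤ ⨆ m, ‖w m‖ := fun n => le_ciSup hw n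
  have hshift : Memℓp (fun n => x (n + 1)) p := by
    rcases eq_or_ne p ∞ with rfl | hp
    · obtain ⟨M, hM⟩ := hx.bddAbove
      refine memℓp_infty ⟨M, ?_⟩
      rintro _ ⟨n, rfl⟩
      exact hM ⟨n + 1, rfl⟩
    · have h0 : 0 < p.toReal :=
        ENNReal.toReal_pos (zero_lt_one.trans_le hp1.out).ne' hp
      exact memℓp_gen (((Equiv.addRight (1 : ℤ)).summable_iff
        (f := fun n => ‖x n‖ ^ p.toReal)).2 (hx.summable h0))
  have hsmul : Memℓp (fun n => ((⨆ m, ‖w m‖ : ℝ) : 𝕜) * x (n + 1)) p :=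
    hshift.const_mul _
  refine (memℓp_norm_iff.2 hsmul).mono ?_
  intro n
  rw [norm_mul, norm_mul, RCLike.norm_ofReal]
  exact mul_le_mul_of_nonneg_right ((hC _).trans (le_abs_self _)) (norm_nonneg _)

/-- The bilateral weighted backward shift `(x_n) ↦ (w_{n+1} x_{n+1})` on `ℓ_p(ℤ)`,
for a bounded sequence `w` of weights. -/
def lpBackwardShift (p : ℝ≥0∞) [hp1 : Fact (1 ≤ p)] (w : ℤ → 𝕜)
    (hw : BddAbove (Set.range fun n => ‖w n‖)) :
    lp (fun _ : ℤ => 𝕜) p →L[𝕜] lp (fun _ : ℤ => 𝕜) p :=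
  LinearMap.mkContinuous
    { toFun := fun x => ⟨fun n => w (n + 1) * x (n + 1), memℓp_backwardShift hw (lp.memℓp x)⟩
      map_add' := by
        intro x y
        ext n
        exact mul_add (w (n + 1)) (x (n + 1)) (y (n + 1))
      map_smul' := by
        intro c x
        ext n
        simp [mul_left_comm] }
    (⨆ m, ‖w m‖) (by
      intro x
      have hC : ∀ n, ‖w n‖ ≤ ⨆ m, ‖w m‖ := fun n => le_ciSup hw n
      have hC0 : 0 ≤ ⨆ m, ‖w m‖ := (norm_nonneg (w 0)).trans (hC 0)
      rcases eq_or_ne p ∞ with rfl | hp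
      · refine lp.norm_le_of_forall_le (mul_nonneg hC0 (norm_nonneg _)) fun n => ?_
        change ‖w (n + 1) * x (n + 1)‖ ≤ _
        rw [norm_mul]
        exact mul_le_mul (hC _) (lp.norm_apply_le_norm ENNReal.top_ne_zero x _)
          (norm_nonneg _) hC0
      · have h0 : 0 < p.toReal :=
          ENNReal.toReal_pos (zero_lt_one.trans_le hp1.out).ne' hp
        refine lp.norm_le_of_forall_sum_le h0 (mul_nonneg hC0 (norm_nonneg _)) fun s => ?_
        change ∑ n ∈ s, ‖w (n + 1) * x (n + 1)‖ ^ p.toReal ≤ _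
        rw [Real.mul_rpow hC0 (norm_nonneg _)]
        have h2 := lp.sum_rpow_le_norm_rpow h0 x (s.map (Equiv.addRight (1 : ℤ)).toEmbedding)
        rw [Finset.sum_map] at h2
        refine le_trans ?_ (mul_le_mul_of_nonneg_left h2 (Real.rpow_nonneg hC0 _))
        rw [Finset.mul_sum]
        refine Finset.sum_le_sum fun n _ => ?_
        rw [norm_mul, Real.mul_rpow (norm_nonneg _) (norm_nonneg _)]
        exact mul_le_mul_of_nonneg_right
          (Real.rpow_le_rpow (norm_nonneg _) (hC _) h0.le)
          (Real.rpow_nonneg (norm_nonneg _) _))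

@[simp]
theorem lpBackwardShift_apply (p : ℝ≥0∞) [Fact (1 ≤ p)] (w : ℤ → 𝕜)
    (hw : BddAbove (Set.range fun n => ‖w n‖)) (x : lp (fun _ : ℤ => 𝕜) p) (n : ℤ) :
    lpBackwardShift p w hw x n = w (n + 1) * x (n + 1) := rfl

theorem tendsto_backwardShift {w : ℤ → 𝕜}
    (hw : BddAbove (Set.range fun n => ‖w n‖)) (x : C₀(ℤ, 𝕜)) :
    Filter.Tendsto (fun n => w (n + 1) * x (n + 1)) (Filter.cocompact ℤ) (nhds 0) := by
  have hC : ∀ n, ‖w n‖ ≤ ⨆ m, ‖w m‖ := fun n => le_ciSup hw n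
  have hx : Filter.Tendsto (fun n : ℤ => x (n + 1)) (Filter.cocompact ℤ) (nhds 0) :=
    (zero_at_infty x).comp (Homeomorph.addRight (1 : ℤ)).isClosedEmbedding.tendsto_cocompact
  have h2 := hx.norm.const_mul (⨆ m, ‖w m‖)
  rw [norm_zero, mul_zero] at h2
  refine squeeze_zero_norm (fun n => ?_) h2
  rw [norm_mul]
  exact mul_le_mul_of_nonneg_right (hC _) (norm_nonneg _)

/-- The bilateral weighted backward shift `(x_n) ↦ (w_{n+1} x_{n+1})` on `c_0(ℤ)`,
for a bounded sequence `w` of weights. Here `ℤ` is discrete, so `C₀(ℤ, 𝕜)` with its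
supremum norm is `c_0(ℤ)`. -/
def c0BackwardShift (w : ℤ → 𝕜) (hw : BddAbove (Set.range fun n => ‖w n‖)) :
    C₀(ℤ, 𝕜) →L[𝕜] C₀(ℤ, 𝕜) :=
  LinearMap.mkContinuous
    { toFun := fun x =>
        { toFun := fun n => w (n + 1) * x (n + 1)
          continuous_toFun := continuous_of_discreteTopology
          zero_at_infty' := tendsto_backwardShift hw x }
      map_add' := by
        intro x y
        ext n
        simp [mul_add]
      map_smul' := by
        intro c x
        ext n
        simp [mul_left_comm] }
    (⨆ m, ‖w m‖) (by
      intro x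
      have hC : ∀ n, ‖w n‖ ≤ ⨆ m, ‖w m‖ := fun n => le_ciSup hw n
      have hC0 : 0 ≤ ⨆ m, ‖w m‖ := (norm_nonneg (w 0)).trans (hC 0)
      rw [← ZeroAtInftyContinuousMap.norm_toBCF_eq_norm,
        BoundedContinuousFunction.norm_le (mul_nonneg hC0 (norm_nonneg _))]
      intro n
      change ‖w (n + 1) * x (n + 1)‖ ≤ _
      rw [norm_mul]
      refine mul_le_mul (hC _) ?_ (norm_nonneg _) hC0
      rw [← ZeroAtInftyContinuousMap.norm_toBCF_eq_norm]
      exact x.toBCF.norm_coe_le_norm (n + 1))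

@[simp]
theorem c0BackwardShift_apply (w : ℤ → 𝕜)
    (hw : BddAbove (Set.range fun n => ‖w n‖)) (x : C₀(ℤ, 𝕜)) (n : ℤ) :
    c0BackwardShift w hw x n = w (n + 1) * x (n + 1) := rfl

end Shifts

/-! ### Dynamical notions for invertible operators -/

section Dynamics

variable {𝕜 X : Type*} [RCLike 𝕜] [NormedAddCommGroup X] [NormedSpace 𝕜 X]

/-- Expansivity: some `e > 0` is such that the two-sided orbits of any two distinct points are at
distance at least `e` at some time `n ∈ ℤ`. -/
def IsExpansive (T : X ≃L[𝕜] X) : Prop :=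
  ∃ e : ℝ, 0 < e ∧ ∀ x y : X, x ≠ y → ∃ n : ℤ, e ≤ dist ((T ^ n) x) ((T ^ n) y)

/-- Strong structural stability: for every `γ > 0` there is `ε > 0` such that, for every bounded
continuous `φ : X → X` with `‖φ‖_∞ ≤ ε` and `Lip(φ) ≤ ε`, some homeomorphism `h` of `X` satisfies
`h ∘ T = (T + φ) ∘ h` and `‖h - I‖_∞ ≤ γ`. -/
def IsStronglyStructurallyStable (T : X ≃L[𝕜] X) : Prop :=
  ∀ γ : ℝ, 0 < γ → ∃ ε : ℝ≥0, 0 < ε ∧ ∀ φ : X →ᵇ X, ‖φ‖ ≤ ε → LipschitzWith ε φ →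
    ∃ h : X ≃ₜ X, (∀ x, h (T x) = T (h x) + φ (h x)) ∧ ∀ x, ‖h x - x‖ ≤ γ

end Dynamics

/-! ### Hyperbolicity -/

/-- An operator on a complex space is hyperbolic if its spectrum (in the algebra of continuous
linear operators) does not meet the unit circle. -/
def IsHyperbolic {X : Type*} [AddCommGroup X] [TopologicalSpace X] [IsTopologicalAddGroup X]
    [Module ℂ X] [ContinuousConstSMul ℂ X] (T : X →L[ℂ] X) : Prop :=
  Disjoint (spectrum ℂ T) (Metric.sphere (0 : ℂ) 1)

/-- The complexification `X ⊕ iX` of a real topological vector space: the pair `(x, y)` stands for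
`x + iy`, and the topology is the product topology (for a Banach space `X`, this is the topology of
any of the usual, mutually equivalent, norms on the complexification). -/
def Complexification (X : Type*) : Type _ := X × X

namespace Complexification

variable {X : Type*} [AddCommGroup X] [TopologicalSpace X] [IsTopologicalAddGroup X]
  [Module ℝ X] [ContinuousConstSMul ℝ X]

instance : AddCommGroup (Complexification X) := inferInstanceAs (AddCommGroup (X × X))

instance : TopologicalSpace (Complexification X) := inferInstanceAs (TopologicalSpace (X × X))

instance : IsTopologicalAddGroup (Complexification X) :=
  inferInstanceAs (IsTopologicalAddGroup (X × X))

/-- `(a + ib)(x + iy) = (ax - by) + i(ay + bx)`. -/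
instance : Module ℂ (Complexification X) where
  smul c z := (c.re • z.1 - c.im • z.2, c.re • z.2 + c.im • z.1)
  one_smul z := by
    refine Prod.ext ?_ ?_
    · change (1 : ℂ).re • z.1 - (1 : ℂ).im • z.2 = z.1
      simp
    · change (1 : ℂ).re • z.2 + (1 : ℂ).im • z.1 = z.2
      simp
  mul_smul c d z := by
    refine Prod.ext ?_ ?_
    · change (c * d).re • z.1 - (c * d).im • z.2
        = c.re • (d.re • z.1 - d.im • z.2) - c.im • (d.re • z.2 + d.im • z.1)
      simp only [Complex.mul_re, Complex.mul_im]
      module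
    · change (c * d).re • z.2 + (c * d).im • z.1
        = c.re • (d.re • z.2 + d.im • z.1) + c.im • (d.re • z.1 - d.im • z.2)
      simp only [Complex.mul_re, Complex.mul_im]
      module
  smul_zero c := by
    refine Prod.ext ?_ ?_
    · change c.re • (0 : X) - c.im • (0 : X) = 0
      simp
    · change c.re • (0 : X) + c.im • (0 : X) = 0
      simp
  smul_add c z z' := by
    refine Prod.ext ?_ ?_
    · change c.re • (z.1 + z'.1) - c.im • (z.2 + z'.2)
        = (c.re • z.1 - c.im • z.2) + (c.re • z'.1 - c.im • z'.2)
      module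
    · change c.re • (z.2 + z'.2) + c.im • (z.1 + z'.1)
        = (c.re • z.2 + c.im • z.1) + (c.re • z'.2 + c.im • z'.1)
      module
  add_smul c d z := by
    refine Prod.ext ?_ ?_
    · change (c + d).re • z.1 - (c + d).im • z.2
        = (c.re • z.1 - c.im • z.2) + (d.re • z.1 - d.im • z.2)
      simp only [Complex.add_re, Complex.add_im]
      module
    · change (c + d).re • z.2 + (c + d).im • z.1
        = (c.re • z.2 + c.im • z.1) + (d.re • z.2 + d.im • z.1)
      simp only [Complex.add_re, Complex.add_im]
      module
  zero_smul z := by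
    refine Prod.ext ?_ ?_
    · change (0 : ℂ).re • z.1 - (0 : ℂ).im • z.2 = 0
      simp
    · change (0 : ℂ).re • z.2 + (0 : ℂ).im • z.1 = 0
      simp

instance : ContinuousConstSMul ℂ (Complexification X) where
  continuous_const_smul c := by
    change Continuous fun z : X × X => (c.re • z.1 - c.im • z.2, c.re • z.2 + c.im • z.1)
    fun_prop

/-- The complexification `T_ℂ (x + iy) = Tx + iTy` of an operator `T`. -/
def map (T : X →L[ℝ] X) : Complexification X →L[ℂ] Complexification X where
  toFun z := (T z.1, T z.2)
  map_add' z z' := by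
    refine Prod.ext ?_ ?_
    · exact T.map_add z.1 z'.1
    · exact T.map_add z.2 z'.2
  map_smul' c z := by
    refine Prod.ext ?_ ?_
    · change T (c.re • z.1 - c.im • z.2) = c.re • T z.1 - c.im • T z.2
      simp
    · change T (c.re • z.2 + c.im • z.1) = c.re • T z.2 + c.im • T z.1
      simp
  cont := by
    change Continuous fun z : X × X => (T z.1, T z.2)
    fun_prop

end Complexification

/-- An operator on a real space is hyperbolic if the spectrum of its complexification does not meet
the unit circle. -/
def IsHyperbolicReal {X : Type*} [AddCommGroup X] [TopologicalSpace X] [IsTopologicalAddGroup X]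
    [Module ℝ X] [ContinuousConstSMul ℝ X] (T : X →L[ℝ] X) : Prop :=
  IsHyperbolic (Complexification.map T)

end

/-! ### Invertibility of `1 - T` from the two dynamical hypotheses. -/

section General

variable {𝕜 X : Type*} [RCLike 𝕜] [NormedAddCommGroup X] [NormedSpace 𝕜 X]

/-! Expansivity makes `1 - T` injective, since a nonzero fixed vector can be rescaled to have a
small constant orbit. Stability makes it surjective: if `h` conjugates `T` to `T + c` with `c`
constant, evaluating at `0` gives `h 0 - T (h 0) = c`. Hence `1` is not in the spectrum
(`isUnit_one_sub_of_isExpansive_of_isStronglyStructurallyStable`).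

None of this uses weights. They enter through rotation symmetry: for `‖μ‖ = 1` the diagonal operator
with entries `μ ^ n` carries invertibility from `1 - T` to `μ - T` (`isHyperbolic_of_shift`). An
injective coordinate map `ι` lets one argument cover `ℓ_p`, `c_0` and their complexifications. -/

theorem IsExpansive.eq_zero_of_apply_eq_self {T : X ≃L[𝕜] X} (hT : IsExpansive T) {x : X}
    (hx : T x = x) : x = 0 := by
  obtain ⟨e, he, hexp⟩ := hT
  by_contra hx0
  have hn : 0 < ‖x‖ := norm_pos_iff.2 hx0
  -- The multiple of norm `e / 2`: its constant orbit stays closer than `e` to that of `0`.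
  set c : ℝ := e / (2 * ‖x‖) with hc
  have hc0 : 0 < c := by positivity
  set y : X := (c : 𝕜) • x with hy
  have hTy : T y = y := by rw [hy, map_smul, hx]
  have hyn : ‖y‖ = e / 2 := by
    rw [hy, norm_smul, RCLike.norm_ofReal, abs_of_pos hc0, hc]
    field_simp
  have hy0 : y ≠ 0 := by
    rw [← norm_pos_iff, hyn]
    positivity
  obtain ⟨n, hle⟩ := hexp y 0 hy0
  have hpow : (T ^ n) y = y := by
    -- The stabilizer of `y` is a subgroup, which handles negative powers too.
    let G : Subgroup (X ≃L[𝕜] X) :=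
      { carrier := {S | S y = y}
        mul_mem' := fun {S R} hS hR => (congrArg S hR).trans hS
        one_mem' := rfl
        inv_mem' := fun {S} hS => (ContinuousLinearEquiv.symm_apply_eq S).2 hS.symm }
    exact G.zpow_mem (show T ∈ G from hTy) n
  rw [hpow, map_zero, dist_zero_right, hyn] at hle
  linarith

/-- Constant perturbations turn structural stability into solvability of `u - T u = c`. -/
theorem IsStronglyStructurallyStable.exists_sub_eq {T : X ≃L[𝕜] X}
    (hT : IsStronglyStructurallyStable T) (c : X) : ∃ u : X, u - T u = c := by
  -- The value `1` is arbitrary: only the conjugacy equation matters, not the distance from `h` to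
  -- the identity.
  obtain ⟨ε, hε, hstab⟩ := hT 1 one_pos
  rcases eq_or_ne c 0 with rfl | hc
  · exact ⟨0, by simp⟩
  have hn : 0 < ‖c‖ := norm_pos_iff.2 hc
  have hε' : (0 : ℝ) < ε := hε
  -- Scaling `c` to norm `ε` makes the constant map an admissible perturbation; linearity undoes the
  -- scaling at the end.
  set r : ℝ := ε / ‖c‖ with hr
  have hr0 : 0 < r := by positivity
  have hnorm : ‖(r : 𝕜) • c‖ = ε := by
    rw [norm_smul, RCLike.norm_ofReal, abs_of_pos hr0, hr]
    field_simp
  obtain ⟨h, hconj, -⟩ := hstab (BoundedContinuousFunction.const X ((r : 𝕜) • c))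
    ((BoundedContinuousFunction.norm_const_le _).trans hnorm.le)
    ((LipschitzWith.const _).weaken zero_le)
  have h0 := hconj 0
  rw [map_zero, BoundedContinuousFunction.const_apply] at h0
  have hr1 : (r : 𝕜) ≠ 0 := by exact_mod_cast hr0.ne'
  refine ⟨(r : 𝕜)⁻¹ • h 0, ?_⟩
  rw [map_smul, ← smul_sub, sub_eq_of_eq_add' h0, inv_smul_smul₀ hr1]

/-- On a Banach space, bijectivity suffices by the open mapping theorem. -/
theorem isUnit_one_sub_of_isExpansive_of_isStronglyStructurallyStable [CompleteSpace X]
    {T : X ≃L[𝕜] X} (hexp : IsExpansive T) (hstab : IsStronglyStructurallyStable T) :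
    IsUnit (1 - (T : X →L[𝕜] X)) := by
  rw [ContinuousLinearMap.isUnit_iff_bijective]
  refine ⟨(injective_iff_map_eq_zero _).2 fun x hx => ?_, fun c => ?_⟩
  · exact hexp.eq_zero_of_apply_eq_self (sub_eq_zero.1 hx).symm
  · exact hstab.exists_sub_eq c

end General

/-! ### Rotation symmetry of the spectrum. -/

/-- Here `D * T * D' = μ⁻¹ • T`, so `μ - T` is `μ` times the conjugate of `1 - T` by `D`. -/
theorem isUnit_algebraMap_sub_of_isUnit_one_sub {K A : Type*} [Field K] [Ring A] [Algebra K A]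
    {T D D' : A} {μ : K} (hμ : μ ≠ 0) (hT : IsUnit (1 - T)) (h₁ : D * D' = 1) (h₂ : D' * D = 1)
    (h : μ • (D * T) = T * D) : IsUnit (algebraMap K A μ - T) := by
  have hD : IsUnit D := ⟨⟨D, D', h₁, h₂⟩, rfl⟩
  have hD' : IsUnit D' := ⟨⟨D', D, h₂, h₁⟩, rfl⟩
  have key : algebraMap K A μ - T = algebraMap K A μ * (D * (1 - T) * D') := by
    rw [mul_sub, mul_one, sub_mul, h₁, mul_sub, mul_one, ← Algebra.smul_def, ← smul_mul_assoc, h,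
      mul_assoc, h₁, mul_one]
  rw [key]
  exact ((isUnit_iff_ne_zero.2 hμ).map (algebraMap K A)).mul ((hD.mul hT).mul hD')

theorem isHyperbolic_of_forall_isUnit {X : Type*} [AddCommGroup X] [TopologicalSpace X]
    [IsTopologicalAddGroup X] [Module ℂ X] [ContinuousConstSMul ℂ X] {T : X →L[ℂ] X}
    (h : ∀ μ : ℂ, ‖μ‖ = 1 → IsUnit (algebraMap ℂ (X →L[ℂ] X) μ - T)) : IsHyperbolic T :=
  Set.disjoint_left.2 fun μ hμ hs => hμ (h μ (mem_sphere_zero_iff_norm.1 hs))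

/-- A weighted backward shift `T` on a complex sequence space that is stable under multiplication
by sequences in the unit disc is hyperbolic as soon as `1 - T` is invertible: the diagonal operator
with entries `μ ^ n` conjugates `T` to `μ⁻¹ • T` when `‖μ‖ = 1`. -/
theorem isHyperbolic_of_shift {X : Type*} [AddCommGroup X] [TopologicalSpace X]
    [IsTopologicalAddGroup X] [Module ℂ X] [ContinuousConstSMul ℂ X] {T : X →L[ℂ] X}
    {w : ℤ → ℂ} (ι : X → ℤ → ℂ) (hι : Function.Injective ι)
    (hsmul : ∀ (c : ℂ) x n, ι (c • x) n = c * ι x n)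
    (hM : ∀ a : ℤ → ℂ, (∀ n, ‖a n‖ ≤ 1) → ∃ M : X →L[ℂ] X, ∀ x n, ι (M x) n = a n * ι x n)
    (hT : ∀ x n, ι (T x) n = w (n + 1) * ι x (n + 1)) (hunit : IsUnit (1 - T)) :
    IsHyperbolic T := by
  refine isHyperbolic_of_forall_isUnit fun μ hμ => ?_
  have hμ0 : μ ≠ 0 := norm_ne_zero_iff.1 (hμ ▸ one_ne_zero)
  obtain ⟨D, hD⟩ := hM (fun n => μ ^ n) fun n => by simp [hμ]
  obtain ⟨D', hD'⟩ := hM (fun n => μ ^ (-n)) fun n => by simp [hμ]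
  refine isUnit_algebraMap_sub_of_isUnit_one_sub (D := D) (D' := D') hμ0 hunit ?_ ?_ ?_
  · refine ContinuousLinearMap.ext fun x => hι (funext fun n => ?_)
    change ι (D (D' x)) n = ι x n
    rw [hD, hD', ← mul_assoc, ← zpow_add₀ hμ0, add_neg_cancel, zpow_zero, one_mul]
  · refine ContinuousLinearMap.ext fun x => hι (funext fun n => ?_)
    change ι (D' (D x)) n = ι x n
    rw [hD', hD, ← mul_assoc, ← zpow_add₀ hμ0, neg_add_cancel, zpow_zero, one_mul]
  · refine ContinuousLinearMap.ext fun x => hι (funext fun n => ?_)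
    change ι (μ • D (T x)) n = ι (T (D x)) n
    -- The factor `μ` comes from the index shift: `T` reads entry `n + 1`, where `D` multiplies by
    -- `μ ^ (n + 1)`.
    rw [hsmul, hD, hT, hT, hD, zpow_add_one₀ hμ0]
    ring

/-! ### Transfer to the complexification. -/

namespace Complexification

variable {X : Type*} [AddCommGroup X] [TopologicalSpace X] [IsTopologicalAddGroup X]
  [Module ℝ X] [ContinuousConstSMul ℝ X]

/-- The operator `A + iB` on the complexification, for real operators `A` and `B`. -/
noncomputable def mapAddI (A B : X →L[ℝ] X) : Complexification X →L[ℂ] Complexification X where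
  toFun z := (A z.1 - B z.2, A z.2 + B z.1)
  map_add' z z' := by
    refine Prod.ext ?_ ?_
    · change A (z.1 + z'.1) - B (z.2 + z'.2) = (A z.1 - B z.2) + (A z'.1 - B z'.2)
      simp only [map_add]
      abel
    · change A (z.2 + z'.2) + B (z.1 + z'.1) = (A z.2 + B z.1) + (A z'.2 + B z'.1)
      simp only [map_add]
      abel
  map_smul' c z := by
    refine Prod.ext ?_ ?_
    · change A (c.re • z.1 - c.im • z.2) - B (c.re • z.2 + c.im • z.1)
        = c.re • (A z.1 - B z.2) - c.im • (A z.2 + B z.1)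
      simp only [map_add, map_sub, map_smul]
      module
    · change A (c.re • z.2 + c.im • z.1) + B (c.re • z.1 - c.im • z.2)
        = c.re • (A z.2 + B z.1) + c.im • (A z.1 - B z.2)
      simp only [map_add, map_sub, map_smul]
      module
  cont := by
    change Continuous fun z : X × X => (A z.1 - B z.2, A z.2 + B z.1)
    fun_prop

omit [ContinuousConstSMul ℝ X] in
-- The inverse is the complexification of the real inverse.
theorem isUnit_one_sub_map {T : X →L[ℝ] X} (hT : IsUnit (1 - T)) : IsUnit (1 - map T) := by
  obtain ⟨u, hu⟩ := hT
  have h₁ : ∀ x, (1 - T) ((↑u⁻¹ : X →L[ℝ] X) x) = x := fun x => by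
    rw [← hu]
    exact congrArg (fun S : X →L[ℝ] X => S x) u.mul_inv
  have h₂ : ∀ x, (↑u⁻¹ : X →L[ℝ] X) ((1 - T) x) = x := fun x => by
    rw [← hu]
    exact congrArg (fun S : X →L[ℝ] X => S x) u.inv_mul
  exact ⟨⟨1 - map T, map ↑u⁻¹,
    ContinuousLinearMap.ext fun z => Prod.ext (h₁ z.1) (h₁ z.2),
    ContinuousLinearMap.ext fun z => Prod.ext (h₂ z.1) (h₂ z.2)⟩, rfl⟩

/-- The sequence of complex coordinates of a point of the complexification of a real sequence
space. -/
noncomputable def coords {Y : Type*} (ι : Y → ℤ → ℝ) (z : Complexification Y) (n : ℤ) : ℂ :=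
  ⟨ι z.1 n, ι z.2 n⟩

theorem coords_injective {Y : Type*} {ι : Y → ℤ → ℝ} (hι : Function.Injective ι) :
    Function.Injective (coords ι) := fun _ _ h =>
  Prod.ext (hι (funext fun n => congrArg Complex.re (congrFun h n)))
    (hι (funext fun n => congrArg Complex.im (congrFun h n)))

omit [TopologicalSpace X] [IsTopologicalAddGroup X] [ContinuousConstSMul ℝ X] in
theorem coords_smul (ι : X →ₗ[ℝ] ℤ → ℝ) (c : ℂ) (z : Complexification X) (n : ℤ) :
    coords ι (c • z) n = c * coords ι z n := by
  apply Complex.ext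
  · change ι (c.re • z.1 - c.im • z.2) n = c.re * ι z.1 n - c.im * ι z.2 n
    simp
  · change ι (c.re • z.2 + c.im • z.1) n = c.re * ι z.2 n + c.im * ι z.1 n
    simp

omit [ContinuousConstSMul ℝ X] in
-- Supplies the diagonal operators with complex entries `μ ^ n`: real and imaginary parts are again
-- bounded by `1`, so they define real multipliers `A` and `B`, combined as `A + iB`.
theorem exists_coords_eq_mul (ι : X →ₗ[ℝ] ℤ → ℝ)
    (hM : ∀ a : ℤ → ℝ, (∀ n, ‖a n‖ ≤ 1) → ∃ M : X →L[ℝ] X, ∀ x n, ι (M x) n = a n * ι x n)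
    (a : ℤ → ℂ) (ha : ∀ n, ‖a n‖ ≤ 1) :
    ∃ M : Complexification X →L[ℂ] Complexification X,
      ∀ z n, coords ι (M z) n = a n * coords ι z n := by
  obtain ⟨A, hA⟩ := hM (fun n => (a n).re) fun n => (Complex.abs_re_le_norm _).trans (ha n)
  obtain ⟨B, hB⟩ := hM (fun n => (a n).im) fun n => (Complex.abs_im_le_norm _).trans (ha n)
  refine ⟨mapAddI A B, fun z n => Complex.ext ?_ ?_⟩
  · change ι (A z.1 - B z.2) n = (a n).re * ι z.1 n - (a n).im * ι z.2 n
    rw [map_sub, Pi.sub_apply, hA, hB]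
  · change ι (A z.2 + B z.1) n = (a n).re * ι z.2 n + (a n).im * ι z.1 n
    rw [map_add, Pi.add_apply, hA, hB]

omit [IsTopologicalAddGroup X] [ContinuousConstSMul ℝ X] in
theorem coords_map (ι : X → ℤ → ℝ) {w : ℤ → ℝ} {T : X →L[ℝ] X}
    (hT : ∀ x n, ι (T x) n = w (n + 1) * ι x (n + 1)) (z : Complexification X) (n : ℤ) :
    coords ι (map T z) n = w (n + 1) * coords ι z (n + 1) := by
  apply Complex.ext
  · rw [Complex.re_ofReal_mul]
    exact hT z.1 n
  · rw [Complex.im_ofReal_mul]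
    exact hT z.2 n

end Complexification

theorem isHyperbolicReal_of_shift {X : Type*} [NormedAddCommGroup X] [NormedSpace ℝ X]
    {T : X →L[ℝ] X} {w : ℤ → ℝ} (ι : X →ₗ[ℝ] ℤ → ℝ) (hι : Function.Injective ι)
    (hM : ∀ a : ℤ → ℝ, (∀ n, ‖a n‖ ≤ 1) → ∃ M : X →L[ℝ] X, ∀ x n, ι (M x) n = a n * ι x n)
    (hT : ∀ x n, ι (T x) n = w (n + 1) * ι x (n + 1)) (hunit : IsUnit (1 - T)) :
    IsHyperbolicReal T :=
  isHyperbolic_of_shift (w := fun n => (w n : ℂ)) (Complexification.coords ι)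
    (Complexification.coords_injective hι) (Complexification.coords_smul ι)
    (Complexification.exists_coords_eq_mul ι hM) (Complexification.coords_map ι hT)
    (Complexification.isUnit_one_sub_map hunit)

/-! ### Coordinates and diagonal multipliers on `ℓ_p(ℤ)` and `c_0(ℤ)`. -/

section Coordinates

variable {𝕜 : Type*} [RCLike 𝕜]

/-- The coordinates of a point of `ℓ_p(ℤ)`. -/
noncomputable def lpCoords (p : ℝ≥0∞) : lp (fun _ : ℤ => 𝕜) p →ₗ[𝕜] ℤ → 𝕜 where
  toFun x := x
  map_add' _ _ := rfl
  map_smul' _ _ := rfl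

theorem lpCoords_injective (p : ℝ≥0∞) :
    Function.Injective (lpCoords p : lp (fun _ : ℤ => 𝕜) p →ₗ[𝕜] ℤ → 𝕜) := fun _ _ h => lp.ext h

theorem exists_lpCoords_eq_mul (p : ℝ≥0∞) [hp : Fact (1 ≤ p)] (a : ℤ → 𝕜)
    (ha : ∀ n, ‖a n‖ ≤ 1) :
    ∃ M : lp (fun _ : ℤ => 𝕜) p →L[𝕜] lp (fun _ : ℤ => 𝕜) p,
      ∀ x n, lpCoords p (M x) n = a n * lpCoords p x n := by
  have hle : ∀ (x : ℤ → 𝕜) n, ‖a n * x n‖ ≤ ‖x n‖ := fun x n => by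
    rw [norm_mul]
    exact mul_le_of_le_one_left (norm_nonneg _) (ha n)
  refine ⟨LinearMap.mkContinuous
    { toFun := fun x => ⟨fun n => a n * x n, (lp.memℓp x).mono' (hle x)⟩
      map_add' := fun x y => lp.ext (funext fun n => mul_add (a n) (x n) (y n))
      map_smul' := fun c x => lp.ext (funext fun n => mul_left_comm (a n) c (x n)) } 1
    fun x => ?_, fun _ _ => rfl⟩
  rw [one_mul]
  exact lp.norm_mono (zero_lt_one.trans_le hp.out).ne' (hle x)

/-- The coordinates of a point of `c_0(ℤ)`. -/
noncomputable def c0Coords : C₀(ℤ, 𝕜) →ₗ[𝕜] ℤ → 𝕜 where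
  toFun x := x
  map_add' _ _ := rfl
  map_smul' _ _ := rfl

theorem c0Coords_injective : Function.Injective (c0Coords : C₀(ℤ, 𝕜) →ₗ[𝕜] ℤ → 𝕜) :=
  DFunLike.coe_injective

theorem exists_c0Coords_eq_mul (a : ℤ → 𝕜) (ha : ∀ n, ‖a n‖ ≤ 1) :
    ∃ M : C₀(ℤ, 𝕜) →L[𝕜] C₀(ℤ, 𝕜), ∀ x n, c0Coords (M x) n = a n * c0Coords x n := by
  have hle : ∀ (x : ℤ → 𝕜) n, ‖a n * x n‖ ≤ ‖x n‖ := fun x n => by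
    rw [norm_mul]
    exact mul_le_of_le_one_left (norm_nonneg _) (ha n)
  refine ⟨LinearMap.mkContinuous
    { toFun := fun x =>
        { toFun := fun n => a n * x n
          continuous_toFun := continuous_of_discreteTopology
          zero_at_infty' := squeeze_zero_norm (hle x) (tendsto_zero_iff_norm_tendsto_zero.1
            (zero_at_infty x)) }
      map_add' := fun x y => DFunLike.ext _ _ fun n => mul_add (a n) (x n) (y n)
      map_smul' := fun c x => DFunLike.ext _ _ fun n => mul_left_comm (a n) c (x n) } 1
    fun x => ?_, fun _ _ => rfl⟩
  rw [one_mul, ← ZeroAtInftyContinuousMap.norm_toBCF_eq_norm,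
    ← ZeroAtInftyContinuousMap.norm_toBCF_eq_norm,
    BoundedContinuousFunction.norm_le (norm_nonneg _)]
  exact fun n => (hle x n).trans (x.toBCF.norm_coe_le_norm n)

end Coordinates

theorem mainTheorem5 :
    -- complex scalars, `ℓ_p(ℤ)` with `1 ≤ p < ∞`
    (∀ (p : ℝ≥0∞) [Fact (1 ≤ p)], p ≠ ∞ →
      ∀ (w : ℤ → ℂ) (hw : BddAbove (Set.range fun n => ‖w n‖))
        (T : lp (fun _ : ℤ => ℂ) p ≃L[ℂ] lp (fun _ : ℤ => ℂ) p),
        (T : lp (fun _ : ℤ => ℂ) p →L[ℂ] lp (fun _ : ℤ => ℂ) p) = lpBackwardShift p w hw →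
        IsExpansive T → IsStronglyStructurallyStable T →
        IsHyperbolic (T : lp (fun _ : ℤ => ℂ) p →L[ℂ] lp (fun _ : ℤ => ℂ) p)) ∧
    -- complex scalars, `c_0(ℤ)`
    (∀ (w : ℤ → ℂ) (hw : BddAbove (Set.range fun n => ‖w n‖)) (T : C₀(ℤ, ℂ) ≃L[ℂ] C₀(ℤ, ℂ)),
        (T : C₀(ℤ, ℂ) →L[ℂ] C₀(ℤ, ℂ)) = c0BackwardShift w hw →
        IsExpansive T → IsStronglyStructurallyStable T →
        IsHyperbolic (T : C₀(ℤ, ℂ) →L[ℂ] C₀(ℤ, ℂ))) ∧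
    -- real scalars, `ℓ_p(ℤ)` with `1 ≤ p < ∞`
    (∀ (p : ℝ≥0∞) [Fact (1 ≤ p)], p ≠ ∞ →
      ∀ (w : ℤ → ℝ) (hw : BddAbove (Set.range fun n => ‖w n‖))
        (T : lp (fun _ : ℤ => ℝ) p ≃L[ℝ] lp (fun _ : ℤ => ℝ) p),
        (T : lp (fun _ : ℤ => ℝ) p →L[ℝ] lp (fun _ : ℤ => ℝ) p) = lpBackwardShift p w hw →
        IsExpansive T → IsStronglyStructurallyStable T →
        IsHyperbolicReal (T : lp (fun _ : ℤ => ℝ) p →L[ℝ] lp (fun _ : ℤ => ℝ) p)) ∧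
    -- real scalars, `c_0(ℤ)`
    (∀ (w : ℤ → ℝ) (hw : BddAbove (Set.range fun n => ‖w n‖)) (T : C₀(ℤ, ℝ) ≃L[ℝ] C₀(ℤ, ℝ)),
        (T : C₀(ℤ, ℝ) →L[ℝ] C₀(ℤ, ℝ)) = c0BackwardShift w hw →
        IsExpansive T → IsStronglyStructurallyStable T →
        IsHyperbolicReal (T : C₀(ℤ, ℝ) →L[ℝ] C₀(ℤ, ℝ))) := by
  refine ⟨fun p _ _ w hw T hT hexp hstab => ?_, fun w hw T hT hexp hstab => ?_,
    fun p _ _ w hw T hT hexp hstab => ?_, fun w hw T hT hexp hstab => ?_⟩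
  all_goals
    have hunit := isUnit_one_sub_of_isExpansive_of_isStronglyStructurallyStable hexp hstab
    rw [hT] at hunit ⊢
  · exact isHyperbolic_of_shift (lpCoords p) (lpCoords_injective p) (fun _ _ _ => rfl)
      (exists_lpCoords_eq_mul p) (lpBackwardShift_apply p w hw) hunit
  · exact isHyperbolic_of_shift c0Coords c0Coords_injective (fun _ _ _ => rfl)
      exists_c0Coords_eq_mul (c0BackwardShift_apply w hw) hunit
  · exact isHyperbolicReal_of_shift (lpCoords p) (lpCoords_injective p)
      (exists_lpCoords_eq_mul p) (lpBackwardShift_apply p w hw) hunit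
  · exact isHyperbolicReal_of_shift c0Coords c0Coords_injective
      exists_c0Coords_eq_mul (c0BackwardShift_apply w hw) hunit
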